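/- Let $1 \le C < L$ be integers and let $\mu_1 > \mu_2 > \cdots > \mu_L \ge 0$ with $\sum_{i=1}^L \mu_i = 1$. Let the requests $x(1), x(2), \ldots$ be i.i.d. with values in $\{1,\ldots,L\}$ and $\mathbb{P}(x(t)=i)=\mu_i$. For $t \ge 1$ put $\hat\mu_i(t) = \frac1t \sum_{\tau=1}^{t} \mathbf{1}\{x(\tau)=i\}$, and $\hat\mu_i(0)=0$. The LFU algorithm with cache size $C$ uses, at each time $t+1$ with $t \ge 0$, a cache $C(t+1) \subseteq \{1,\ldots,L\}$ consisting of $C$ items whose values $\hat\mu_i(t)$ are the $C$ largest; that is, $|C(t+1)| = C$ and $\hat\mu_j(t) \le \hat\mu_i(t)$ for all $i \in C(t+1)$, $j \notin C(t+1)$. Ties (in particular the choice of $C(1)$) are broken arbitrarily, as a measurable function of $x(1),\ldots,x(t)$ and possibly of a random seed independent of all requests. Define the regret $$R(T) = \sum_{t=1}^{T} \left( \mathbf{1}\{x(t) \in \{1,\ldots,C\}\} - \mathbf{1}\{x(t) \in C(t)\} \right).$$ Then, with $\Delta_{\min} = \mu_C - \mu_{C+1}$, for every integer $T \ge 0$,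 $$\mathbb{E}[R(T)] < \min\left( \frac{16}{\Delta_{\min}^2}, \frac{4C(L-C)}{\Delta_{\min}} \right).$$ In particular, the expected regret of LFU is $O(1)$ as $T \to \infty$. -/

import Mathlib

open MeasureTheory ProbabilityTheory

/-- Empirical popularity of item `i` in a list `h` of `n` requests,
`(1/n) ∑_τ 1{h τ = i}`; it is `0` for every item when `n = 0`. -/
noncomputable def empiricalFreq {L n : ℕ} (h : Fin n → Fin L) (i : Fin L) : ℝ :=
  (1 / (n : ℝ)) * ∑ τ : Fin n, if h τ = i then (1 : ℝ) else 0

/-- `S` is a set of indices of the top `C` entries of the vector `v`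
(several sets qualify when there are ties). -/
def IsTopSet {L : ℕ} (C : ℕ) (v : Fin L → ℝ) (S : Finset (Fin L)) : Prop :=
  S.card = C ∧ ∀ i ∈ S, ∀ j ∉ S, v j ≤ v i

/-- A caching policy under full observation with internal randomness in `𝓤`: from the `n` requests
at times `1, …, n` and the seed it selects the cache content for time `n + 1`. -/
abbrev CachingPolicy (L : ℕ) (𝓤 : Type*) : Type _ :=
  (n : ℕ) → (Fin n → Fin L) → 𝓤 → Finset (Fin L)

/-- LFU with cache size `C`: the cache always holds the top `C` items for the empirical
popularities of all past requests. Ties are broken in an arbitrary, possibly randomized,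
(measurable) way that may depend on the past requests. -/
structure IsLFU {L : ℕ} {𝓤 : Type*} [MeasurableSpace 𝓤] (C : ℕ) (π : CachingPolicy L 𝓤) :
    Prop where
  measurable : ∀ (n : ℕ) (h : Fin n → Fin L) (S : Finset (Fin L)), MeasurableSet {u | π n h u = S}
  top : ∀ (n : ℕ) (h : Fin n → Fin L) (u : 𝓤), IsTopSet C (empiricalFreq h) (π n h u)

/-- The cache content at time `n + 1` for the request sequence `r`, where `r k` is the request
at time `k + 1`. -/
def cacheAt {L : ℕ} {𝓤 : Type*} (π : CachingPolicy L 𝓤) (u : 𝓤) (r : ℕ → Fin L) (n : ℕ) :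
    Finset (Fin L) :=
  π n (fun τ : Fin n => r τ) u

/-- The optimal cache content: the first `C` items. -/
def optimalCache (L C : ℕ) : Finset (Fin L) :=
  Finset.univ.filter fun i => i.val < C

/-- Cumulative regret over the times `1, …, T` on the request sequence `r`. -/
noncomputable def regret {L : ℕ} {𝓤 : Type*} (C : ℕ) (π : CachingPolicy L 𝓤) (u : 𝓤)
    (r : ℕ → Fin L) (T : ℕ) : ℝ :=
  ∑ n ∈ Finset.range T,
    ((if r n ∈ optimalCache L C then (1 : ℝ) else 0) -
      (if r n ∈ cacheAt π u r n then (1 : ℝ) else 0))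

/-- `μ_C - μ_{C+1}` in one-based numbering of the items. -/
def deltaMin {L : ℕ} (μ : Fin L → ℝ) (C : ℕ) (hCL : C < L) : ℝ :=
  μ ⟨C - 1, by omega⟩ - μ ⟨C, hCL⟩

/-! The cache at each time depends only on the seed and the earlier requests, so the current request
can be averaged out: the expected regret is the sum over `n` of the expected gap in popularity mass
between the optimal cache and the LFU cache (`integral_regret`). Each bound comes from its own
estimate of this gap; write Δ for `deltaMin`.

For 16/Δ², a wrong cache forces the squared deviation of the count vector to be at least (nΔ)²/2.
Its second moment is at most 6n², so Markov's inequality bounds the gap by 24/(Δ⁴n²). This serves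
for n above about 5/Δ², and the trivial bound 1 before that.

For the pair bound, the gap is at most the sum of δ = μ i - μ j over optimal `i` outside the cache
and suboptimal `j` inside it. Each such pair has inverted counts, an event whose indicator is
dominated by a product of i.i.d. weights of mean at most 1 - δ²/2. The geometric series contributes
δ · 2/δ² ≤ 2/Δ per pair, and there are C(L - C) pairs. -/

/-! ### Independence and averaging over the current request -/

section Probability

variable {Ω : Type*} [MeasurableSpace Ω] {P : Measure Ω}

/-- If `X` is independent of `(Y, Z)` and `Y` is independent of `Z`, then `(X, Y)` is independent
of `Z`. -/
theorem indepFun_prodMk_of_indepFun_prodMk [IsProbabilityMeasure P] {α β γ : Type*} [MeasurableSpace α] [MeasurableSpace β]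
    [MeasurableSpace γ] {X : Ω → α} {Y : Ω → β} {Z : Ω → γ} (hX : Measurable X) (hY : Measurable Y)
    (hZ : Measurable Z) (h₁ : IndepFun X (fun ω => (Y ω, Z ω)) P) (h₂ : IndepFun Y Z P) :
    IndepFun (fun ω => (X ω, Y ω)) Z P := by
  have hXY : IndepFun X Y P := h₁.comp measurable_id measurable_fst
  rw [indepFun_iff_map_prod_eq_prod_map_map (by fun_prop) (by fun_prop)] at *
  have := Measure.isProbabilityMeasure_map (μ := P) hX.aemeasurable
  have := Measure.isProbabilityMeasure_map (μ := P) hY.aemeasurable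
  have := Measure.isProbabilityMeasure_map (μ := P) hZ.aemeasurable
  -- After reassociation, both sides are the product of the three marginal laws.
  apply MeasurableEquiv.prodAssoc.map_measurableEquiv_injective
  rw [hXY, Measure.prodAssoc_prod, ← h₂, ← h₁, Measure.map_map (by fun_prop) (by fun_prop)]
  rfl

/-- Averaging out a finitely valued random variable that is independent of the other argument. -/
theorem integral_comp_eq_integral_sum_of_indepFun {α ι : Type*} [MeasurableSpace α] [Fintype ι]
    [MeasurableSpace ι] [MeasurableSingletonClass ι] {Z : Ω → α} {Y : Ω → ι}
    (h : IndepFun Z Y P) (hY : Measurable Y) {F : α → ι → ℝ}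
    (hF : ∀ i, Measurable fun a => F a i) (hint : ∀ i, Integrable (fun ω => F (Z ω) i) P) :
    ∫ ω, F (Z ω) (Y ω) ∂P = ∫ ω, ∑ i, P.real {ω | Y ω = i} * F (Z ω) i ∂P := by
  classical
  have hset : ∀ i, MeasurableSet {ω | Y ω = i} := fun i => hY (measurableSet_singleton i)
  have hsplit : ∀ ω, F (Z ω) (Y ω) =
      ∑ i, F (Z ω) i * ({i} : Set ι).indicator (fun _ => (1 : ℝ)) (Y ω) := by
    intro ω
    rw [Finset.sum_eq_single (Y ω)] <;> simp +contextual [eq_comm]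
  have hmeas : ∀ i, Measurable fun y => ({i} : Set ι).indicator (fun _ => (1 : ℝ)) y :=
    fun i => measurable_const.indicator (measurableSet_singleton i)
  have hbdd : ∀ i, Integrable
      (fun ω => F (Z ω) i * ({i} : Set ι).indicator (fun _ => (1 : ℝ)) (Y ω)) P := by
    intro i
    refine (hint i).mul_bdd (c := 1) ((hmeas i).comp hY).aestronglyMeasurable
      (Filter.Eventually.of_forall fun ω => ?_)
    by_cases hi : Y ω = i <;> simp [hi]
  simp_rw [hsplit]
  rw [integral_finsetSum _ fun i _ => hbdd i,
    integral_finsetSum _ fun i _ => (hint i).const_mul _]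
  refine Finset.sum_congr rfl fun i _ => ?_
  have hind := h.comp (hF i) (hmeas i)
  have hmul := hind.integral_fun_mul_eq_mul_integral (hint i).aestronglyMeasurable
    ((hmeas i).comp hY).aestronglyMeasurable
  simp only [Function.comp_apply] at hmul
  have hY' : ∫ ω, ({i} : Set ι).indicator (fun _ => (1 : ℝ)) (Y ω) ∂P = P.real {ω | Y ω = i} := by
    rw [← integral_indicator_one (hset i)]
    rfl
  rw [hmul, integral_const_mul, hY', mul_comm]

variable {L : ℕ} {x : ℕ → Ω → Fin L}

theorem integrable_comp_history [IsProbabilityMeasure P] (hx : ∀ n, Measurable (x n)) {n : ℕ}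
    (G : (Fin n → Fin L) → ℝ) : Integrable (fun ω => G fun k => x k ω) P := by
  have hm : Measurable fun ω => fun k : Fin n => x k ω := measurable_pi_lambda _ fun k => hx k
  exact (Integrable.of_finite (f := G) (μ := P.map _)).comp_measurable hm

theorem indepFun_history (hx : ∀ n, Measurable (x n)) (hindep : iIndepFun x P) (n : ℕ) :
    IndepFun (fun ω => fun k : Fin n => x k ω) (x n) P := by
  have h := hindep.indepFun_finset (Finset.range n) {n} (by simp) hx
  have hlast : Measurable fun a : ({n} : Finset ℕ) → Fin L =>
      a ⟨n, Finset.mem_singleton_self n⟩ := measurable_pi_apply _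
  exact h.comp (φ := fun a (k : Fin n) => a ⟨k, Finset.mem_range.2 k.2⟩) (by fun_prop) hlast

theorem indepFun_seed_history [IsProbabilityMeasure P] {𝓤 : Type*} [MeasurableSpace 𝓤] {U : Ω → 𝓤}
    (hx : ∀ n, Measurable (x n)) (hindep : iIndepFun x P) (hU : Measurable U)
    (hUx : IndepFun U (fun ω n => x n ω) P) (n : ℕ) :
    IndepFun (fun ω => (U ω, fun k : Fin n => x k ω)) (x n) P := by
  refine indepFun_prodMk_of_indepFun_prodMk hU (measurable_pi_lambda _ fun k => hx k) (hx n) ?_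
    (indepFun_history hx hindep n)
  exact hUx.comp (φ := id) (ψ := fun a : ℕ → Fin L => (fun k : Fin n => a k, a n))
    measurable_id (by fun_prop)

/-- The request `x n` can be averaged out given the earlier requests. -/
theorem integral_history_succ [IsProbabilityMeasure P] {μ : Fin L → ℝ} (hx : ∀ n, Measurable (x n))
    (hlaw : ∀ n i, P.real {ω | x n ω = i} = μ i) (hindep : iIndepFun x P) {n : ℕ}
    (F : (Fin n → Fin L) → Fin L → ℝ) :
    ∫ ω, F (fun k => x k ω) (x n ω) ∂P = ∫ ω, ∑ i, μ i * F (fun k => x k ω) i ∂P := by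
  rw [integral_comp_eq_integral_sum_of_indepFun (indepFun_history hx hindep n) (hx n)
    (fun i => measurable_of_finite _) fun i => integrable_comp_history hx fun h => F h i]
  simp_rw [hlaw]

end Probability

/-! ### Moments of the squared deviation of the counts -/

section Moments

variable {L : ℕ}

/-- Squared Euclidean length of the vector of deviations of the counts of `h` from their means. -/
def sqDeviation {n : ℕ} (μ : Fin L → ℝ) (h : Fin n → Fin L) : ℝ :=
  ∑ i, (∑ τ, ((if h τ = i then (1 : ℝ) else 0) - μ i)) ^ 2

variable {μ : Fin L → ℝ}

theorem sum_sq_add_step (s : Fin L → ℝ) (k : Fin L) :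
    ∑ i, (s i + ((if k = i then (1 : ℝ) else 0) - μ i)) ^ 2 =
      ∑ i, s i ^ 2 + 2 * (s k - ∑ i, s i * μ i) + (1 - 2 * μ k + ∑ i, μ i ^ 2) := by
  have h : ∀ i, (s i + ((if k = i then (1 : ℝ) else 0) - μ i)) ^ 2 =
      s i ^ 2 + 2 * ((if k = i then s i else 0) - s i * μ i) +
        ((if k = i then 1 else 0) - 2 * (if k = i then μ i else 0) + μ i ^ 2) := by
    intro i
    split_ifs <;> ring
  simp only [h, Finset.sum_add_distrib, Finset.sum_sub_distrib, ← Finset.mul_sum,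
    Finset.sum_ite_eq, Finset.mem_univ, if_true]

/-- The increment of the deviation vector is centred, so its inner product with a fixed `s` has mean
zero. -/
theorem sum_mul_step_inner (hsum : ∑ i, μ i = 1) (s : Fin L → ℝ) :
    ∑ k, μ k * (s k - ∑ i, s i * μ i) = 0 := by
  simp only [mul_sub, Finset.sum_sub_distrib, ← Finset.sum_mul, hsum, one_mul]
  simp [mul_comm]

theorem sum_mul_step_sq (hsum : ∑ i, μ i = 1) :
    ∑ k, μ k * (1 - 2 * μ k + ∑ i, μ i ^ 2) = 1 - ∑ i, μ i ^ 2 := by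
  have h : ∀ k, μ k * (1 - 2 * μ k + ∑ i, μ i ^ 2) =
      μ k - 2 * μ k ^ 2 + μ k * ∑ i, μ i ^ 2 := fun k => by ring
  simp only [h, Finset.sum_add_distrib, Finset.sum_sub_distrib, ← Finset.mul_sum,
    ← Finset.sum_mul, hsum]
  ring

theorem sum_mul_sum_sq_add_step_le (hsum : ∑ i, μ i = 1) (s : Fin L → ℝ) :
    ∑ k, μ k * ∑ i, (s i + ((if k = i then (1 : ℝ) else 0) - μ i)) ^ 2 ≤ ∑ i, s i ^ 2 + 1 := by
  have h : ∀ k, μ k * ∑ i, (s i + ((if k = i then (1 : ℝ) else 0) - μ i)) ^ 2 =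
      μ k * ∑ i, s i ^ 2 + 2 * (μ k * (s k - ∑ i, s i * μ i)) +
        μ k * (1 - 2 * μ k + ∑ i, μ i ^ 2) := fun k => by
    rw [sum_sq_add_step]
    ring
  simp only [h, Finset.sum_add_distrib]
  rw [← Finset.sum_mul, ← Finset.mul_sum, hsum, sum_mul_step_inner hsum, sum_mul_step_sq hsum]
  have : 0 ≤ ∑ i, μ i ^ 2 := Finset.sum_nonneg fun _ _ => sq_nonneg _
  linarith

/-- With q = |s|², p the inner product of `s` with the increment, and y the increment's squared
length, expand (q + 2p + y)². Then 4py ≤ 2p² + 2y², Cauchy–Schwarz p² ≤ qy and y ≤ 2 leave q² + 4qp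
+ (8q + 6)y. This is affine in p and y, whose means are known. -/
theorem sq_sum_sq_add_step_le (hpos : ∀ i, 0 ≤ μ i) (hsum : ∑ i, μ i = 1) (s : Fin L → ℝ)
    (k : Fin L) :
    (∑ i, (s i + ((if k = i then (1 : ℝ) else 0) - μ i)) ^ 2) ^ 2 ≤
      (∑ i, s i ^ 2) ^ 2 + 4 * (∑ i, s i ^ 2) * (s k - ∑ i, s i * μ i) +
        (8 * (∑ i, s i ^ 2) + 6) * (1 - 2 * μ k + ∑ i, μ i ^ 2) := by
  have hcs := Finset.sum_mul_sq_le_sq_mul_sq Finset.univ s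
    fun i => (if k = i then (1 : ℝ) else 0) - μ i
  have hp : ∑ i, s i * ((if k = i then (1 : ℝ) else 0) - μ i) = s k - ∑ i, s i * μ i := by
    simp [mul_sub, Finset.sum_sub_distrib]
  have hy : ∑ i, ((if k = i then (1 : ℝ) else 0) - μ i) ^ 2 = 1 - 2 * μ k + ∑ i, μ i ^ 2 := by
    simpa using sum_sq_add_step (μ := μ) 0 k
  have hy0 : 0 ≤ ∑ i, ((if k = i then (1 : ℝ) else 0) - μ i) ^ 2 :=
    Finset.sum_nonneg fun _ _ => sq_nonneg _
  have hle : ∑ i, μ i ^ 2 ≤ 1 := by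
    rw [← hsum]
    refine Finset.sum_le_sum fun i _ => ?_
    have : μ i ≤ 1 := hsum ▸ Finset.single_le_sum (fun j _ => hpos j) (Finset.mem_univ i)
    nlinarith [hpos i]
  rw [sum_sq_add_step]
  rw [hp, hy] at hcs
  rw [hy] at hy0
  have hy2 : 1 - 2 * μ k + ∑ i, μ i ^ 2 ≤ 2 := by linarith [hpos k]
  generalize 1 - 2 * μ k + ∑ i, μ i ^ 2 = y at *
  generalize s k - ∑ i, s i * μ i = p at *
  generalize ∑ i, s i ^ 2 = q at *
  nlinarith [sq_nonneg (p - y), mul_nonneg hy0 (sub_nonneg.2 hy2)]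

theorem sum_mul_sq_sum_sq_add_step_le (hpos : ∀ i, 0 ≤ μ i) (hsum : ∑ i, μ i = 1)
    (s : Fin L → ℝ) :
    ∑ k, μ k * (∑ i, (s i + ((if k = i then (1 : ℝ) else 0) - μ i)) ^ 2) ^ 2 ≤
      (∑ i, s i ^ 2) ^ 2 + 8 * (∑ i, s i ^ 2) + 6 := by
  have hq : 0 ≤ ∑ i, s i ^ 2 := Finset.sum_nonneg fun _ _ => sq_nonneg _
  have hm : 0 ≤ ∑ i, μ i ^ 2 := Finset.sum_nonneg fun _ _ => sq_nonneg _
  calc _ ≤ ∑ k, (μ k * (∑ i, s i ^ 2) ^ 2 +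
        4 * (∑ i, s i ^ 2) * (μ k * (s k - ∑ i, s i * μ i)) +
        (8 * (∑ i, s i ^ 2) + 6) * (μ k * (1 - 2 * μ k + ∑ i, μ i ^ 2))) := by
        refine Finset.sum_le_sum fun k _ => ?_
        have := mul_le_mul_of_nonneg_left (sq_sum_sq_add_step_le hpos hsum s k) (hpos k)
        linarith
    _ = (∑ i, s i ^ 2) ^ 2 + (8 * (∑ i, s i ^ 2) + 6) * (1 - ∑ i, μ i ^ 2) := by
        rw [Finset.sum_add_distrib, Finset.sum_add_distrib, ← Finset.sum_mul, ← Finset.mul_sum,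
          ← Finset.mul_sum, hsum, sum_mul_step_inner hsum, sum_mul_step_sq hsum]
        ring
    _ ≤ _ := by nlinarith

variable {Ω : Type*} [MeasurableSpace Ω] {P : Measure Ω} [IsProbabilityMeasure P]
  {x : ℕ → Ω → Fin L}

theorem sqDeviation_succ (r : ℕ → Fin L) (n : ℕ) :
    sqDeviation μ (fun k : Fin (n + 1) => r k) =
      ∑ i, (∑ τ : Fin n, ((if r τ = i then (1 : ℝ) else 0) - μ i) +
        ((if r n = i then (1 : ℝ) else 0) - μ i)) ^ 2 := by
  simp only [sqDeviation, Fin.sum_univ_castSucc, Fin.val_castSucc, Fin.val_last]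

theorem integral_sqDeviation_le (hsum : ∑ i, μ i = 1) (hx : ∀ n, Measurable (x n))
    (hlaw : ∀ n i, P.real {ω | x n ω = i} = μ i) (hindep : iIndepFun x P) (n : ℕ) :
    ∫ ω, sqDeviation μ (fun k : Fin n => x k ω) ∂P ≤ n := by
  induction n with
  | zero => simp [sqDeviation]
  | succ n ih =>
    have hs : ∀ ω, sqDeviation μ (fun k : Fin (n + 1) => x k ω) =
        ∑ i, (∑ τ : Fin n, ((if x τ ω = i then (1 : ℝ) else 0) - μ i) +
          ((if x n ω = i then (1 : ℝ) else 0) - μ i)) ^ 2 :=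
      fun ω => sqDeviation_succ (fun k => x k ω) n
    simp only [hs]
    rw [integral_history_succ hx hlaw hindep (n := n) fun h j =>
      ∑ i, (∑ τ : Fin n, ((if h τ = i then (1 : ℝ) else 0) - μ i) +
          ((if j = i then (1 : ℝ) else 0) - μ i)) ^ 2]
    calc _ ≤ ∫ ω, (sqDeviation μ (fun k : Fin n => x k ω) + 1) ∂P :=
          integral_mono (integrable_comp_history hx (n := n) fun h => ∑ j, μ j *
            ∑ i, (∑ τ : Fin n, ((if h τ = i then (1 : ℝ) else 0) - μ i) +
              ((if j = i then (1 : ℝ) else 0) - μ i)) ^ 2)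
            (integrable_comp_history hx fun h => sqDeviation μ h + 1)
            fun ω => sum_mul_sum_sq_add_step_le hsum _
      _ ≤ _ := by
          rw [integral_add (integrable_comp_history hx _) (integrable_const _)]
          simpa using ih

theorem integral_sqDeviation_sq_le (hpos : ∀ i, 0 ≤ μ i) (hsum : ∑ i, μ i = 1)
    (hx : ∀ n, Measurable (x n))
    (hlaw : ∀ n i, P.real {ω | x n ω = i} = μ i) (hindep : iIndepFun x P) (n : ℕ) :
    ∫ ω, sqDeviation μ (fun k : Fin n => x k ω) ^ 2 ∂P ≤ 6 * (n : ℝ) ^ 2 := by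
  induction n with
  | zero => simp [sqDeviation]
  | succ n ih =>
    have hs : ∀ ω, sqDeviation μ (fun k : Fin (n + 1) => x k ω) =
        ∑ i, (∑ τ : Fin n, ((if x τ ω = i then (1 : ℝ) else 0) - μ i) +
          ((if x n ω = i then (1 : ℝ) else 0) - μ i)) ^ 2 :=
      fun ω => sqDeviation_succ (fun k => x k ω) n
    simp only [hs]
    rw [integral_history_succ hx hlaw hindep (n := n) fun h j =>
      (∑ i, (∑ τ : Fin n, ((if h τ = i then (1 : ℝ) else 0) - μ i) +
          ((if j = i then (1 : ℝ) else 0) - μ i)) ^ 2) ^ 2]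
    calc _ ≤ ∫ ω, (sqDeviation μ (fun k : Fin n => x k ω) ^ 2 +
            8 * sqDeviation μ (fun k : Fin n => x k ω) + 6) ∂P :=
          integral_mono (integrable_comp_history hx (n := n) fun h => ∑ j, μ j *
            (∑ i, (∑ τ : Fin n, ((if h τ = i then (1 : ℝ) else 0) - μ i) +
              ((if j = i then (1 : ℝ) else 0) - μ i)) ^ 2) ^ 2)
            (integrable_comp_history hx fun h => sqDeviation μ h ^ 2 + 8 * sqDeviation μ h + 6)
            fun ω => sum_mul_sq_sum_sq_add_step_le hpos hsum _
      _ ≤ _ := by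
          rw [integral_add (integrable_comp_history hx fun h =>
              sqDeviation μ h ^ 2 + 8 * sqDeviation μ h) (integrable_const _),
            integral_add (integrable_comp_history hx fun h => sqDeviation μ h ^ 2)
              (integrable_comp_history hx fun h => 8 * sqDeviation μ h), integral_const_mul]
          have := integral_sqDeviation_le hsum hx hlaw hindep n
          simp only [integral_const, probReal_univ, one_smul]
          push_cast
          -- The recursion closes because 6n² + 8n + 6 ≤ 6(n + 1)².
          nlinarith

/-! ### Exponential weights for a pair of items -/

/-- Weight of a request in the likelihood-type supermartingale comparing items `i` and `j`. -/
noncomputable def pairWeight (μ : Fin L → ℝ) (i j k : Fin L) : ℝ :=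
  if k = j then 1 + (μ i - μ j) else if k = i then (1 + (μ i - μ j))⁻¹ else 1

theorem pairWeight_nonneg {i j : Fin L} (h : μ j ≤ μ i) (k : Fin L) : 0 ≤ pairWeight μ i j k := by
  unfold pairWeight
  have : 0 ≤ 1 + (μ i - μ j) := by linarith
  split_ifs <;> positivity

/-- With δ = μ i - μ j the mean is 1 - δ²(1 - μ j)/(1 + δ), and (1 - μ j)/(1 + δ) ≥ 1/2 is
equivalent to μ i + μ j ≤ 1. -/
theorem sum_mul_pairWeight_le (hpos : ∀ i, 0 ≤ μ i) (hsum : ∑ i, μ i = 1) {i j : Fin L}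
    (h : μ j < μ i) : ∑ k, μ k * pairWeight μ i j k ≤ 1 - (μ i - μ j) ^ 2 / 2 := by
  have hij : i ≠ j := fun e => by simp [e] at h
  have hw : ∀ k, μ k * pairWeight μ i j k = μ k + (if k = j then μ k * (μ i - μ j) else 0) +
      (if k = i then μ k * ((1 + (μ i - μ j))⁻¹ - 1) else 0) := by
    intro k
    unfold pairWeight
    by_cases hj : k = j
    · simp only [hj, if_true, if_neg (Ne.symm hij)]
      ring
    · simp only [if_neg hj]
      split_ifs <;> ring
  have hle : μ i + μ j ≤ 1 := by
    rw [← hsum, ← Finset.sum_pair hij]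
    exact Finset.sum_le_sum_of_subset_of_nonneg (Finset.subset_univ _) fun k _ _ => hpos k
  simp only [hw, Finset.sum_add_distrib, Finset.sum_ite_eq', Finset.mem_univ, if_true, hsum]
  have hd : 0 < 1 + (μ i - μ j) := by linarith
  have e : 1 - (μ i - μ j) ^ 2 / 2 -
      (1 + μ j * (μ i - μ j) + μ i * ((1 + (μ i - μ j))⁻¹ - 1)) =
      (μ i - μ j) ^ 2 * (1 - μ i - μ j) / (2 * (1 + (μ i - μ j))) := by
    field_simp
    ring
  have : 0 ≤ (μ i - μ j) ^ 2 * (1 - μ i - μ j) / (2 * (1 + (μ i - μ j))) :=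
    div_nonneg (mul_nonneg (sq_nonneg _) (by linarith)) (by linarith)
  linarith

theorem integral_prod_pairWeight (hx : ∀ n, Measurable (x n))
    (hlaw : ∀ n i, P.real {ω | x n ω = i} = μ i) (hindep : iIndepFun x P) (i j : Fin L) (n : ℕ) :
    ∫ ω, ∏ τ : Fin n, pairWeight μ i j (x τ ω) ∂P = (∑ k, μ k * pairWeight μ i j k) ^ n := by
  induction n with
  | zero => simp
  | succ n ih =>
    simp only [Fin.prod_univ_castSucc, Fin.val_castSucc, Fin.val_last]
    rw [integral_history_succ hx hlaw hindep (n := n) fun h k =>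
      (∏ τ : Fin n, pairWeight μ i j (h τ)) * pairWeight μ i j k, pow_succ, ← ih,
      ← integral_mul_const]
    refine integral_congr_ae (Filter.Eventually.of_forall fun ω => ?_)
    simp only [Finset.mul_sum]
    exact Finset.sum_congr rfl fun k _ => by ring

theorem prod_pairWeight {n : ℕ} {i j : Fin L} (hij : i ≠ j) (h : Fin n → Fin L) :
    ∏ τ, pairWeight μ i j (h τ) =
      (1 + (μ i - μ j)) ^ (Finset.univ.filter fun τ => h τ = j).card *
        (1 + (μ i - μ j))⁻¹ ^ (Finset.univ.filter fun τ => h τ = i).card := by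
  rw [← Finset.prod_const, ← Finset.prod_const, Finset.prod_filter, Finset.prod_filter,
    ← Finset.prod_mul_distrib]
  refine Finset.prod_congr rfl fun τ _ => ?_
  unfold pairWeight
  by_cases hj : h τ = j
  · simp [hj, Ne.symm hij]
  · simp [hj]

/-- The product is (1 + δ) to the power (count of `j`) - (count of `i`), so it dominates the
indicator of an inverted pair. -/
theorem one_le_prod_pairWeight {n : ℕ} {i j : Fin L} (hμ : μ j < μ i) (h : Fin n → Fin L)
    (hcard : (Finset.univ.filter fun τ => h τ = i).card ≤
      (Finset.univ.filter fun τ => h τ = j).card) :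
    1 ≤ ∏ τ, pairWeight μ i j (h τ) := by
  have hij : i ≠ j := fun e => by simp [e] at hμ
  have ha : 1 ≤ 1 + (μ i - μ j) := by linarith
  rw [prod_pairWeight hij, inv_pow, ← div_eq_mul_inv, one_le_div (by positivity)]
  exact pow_le_pow_right₀ ha hcard

end Moments

/-! ### Deterministic bounds on the gap of a top set -/

section Cache

variable {L C : ℕ}

theorem mem_optimalCache {i : Fin L} : i ∈ optimalCache L C ↔ i.val < C := by
  simp [optimalCache]

theorem card_optimalCache (hCL : C ≤ L) : (optimalCache L C).card = C := by
  simp [optimalCache, Fin.card_filter_val_lt, hCL]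

theorem sum_indicator_eq_card {n : ℕ} (h : Fin n → Fin L) (i : Fin L) :
    ∑ τ, (if h τ = i then (1 : ℝ) else 0) = (Finset.univ.filter fun τ => h τ = i).card := by
  simp

theorem IsTopSet.count_le {n : ℕ} {h : Fin n → Fin L} {S : Finset (Fin L)}
    (hS : IsTopSet C (empiricalFreq h) S) {i j : Fin L} (hi : i ∉ S) (hj : j ∈ S) :
    (Finset.univ.filter fun τ => h τ = i).card ≤ (Finset.univ.filter fun τ => h τ = j).card := by
  -- For `n = 0` all counts vanish; otherwise the factor 1/n cancels.
  rcases Nat.eq_zero_or_pos n with rfl | hn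
  · simp
  · have hle := hS.2 j hj i hi
    unfold empiricalFreq at hle
    rw [sum_indicator_eq_card, sum_indicator_eq_card] at hle
    have hn' : (0 : ℝ) < 1 / n := by positivity
    exact_mod_cast le_of_mul_le_mul_left hle hn'

variable {μ : Fin L → ℝ}

theorem deltaMin_pos (hμ : StrictAnti μ) (hC : 1 ≤ C) (hCL : C < L) : 0 < deltaMin μ C hCL :=
  sub_pos.2 (hμ (Fin.mk_lt_mk.2 (by omega)))

theorem deltaMin_le_sub (hμ : StrictAnti μ) (hCL : C < L) {i j : Fin L}
    (hi : i ∈ optimalCache L C) (hj : j ∉ optimalCache L C) :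
    deltaMin μ C hCL ≤ μ i - μ j := by
  rw [mem_optimalCache] at hi hj
  exact sub_le_sub (hμ.antitone (Fin.le_def.2 (by simp only []; omega)))
    (hμ.antitone (Fin.le_def.2 (by simp only []; omega)))

/-- Loss in hit probability when the cache is `S` instead of the optimal one. -/
def hitGap (μ : Fin L → ℝ) (C : ℕ) (S : Finset (Fin L)) : ℝ :=
  ∑ i ∈ optimalCache L C, μ i - ∑ i ∈ S, μ i

theorem hitGap_le_one (hpos : ∀ i, 0 ≤ μ i) (hsum : ∑ i, μ i = 1) (S : Finset (Fin L)) :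
    hitGap μ C S ≤ 1 := by
  have h₁ : ∑ i ∈ optimalCache L C, μ i ≤ 1 := hsum ▸
    Finset.sum_le_sum_of_subset_of_nonneg (Finset.subset_univ _) fun k _ _ => hpos k
  have h₂ : 0 ≤ ∑ i ∈ S, μ i := Finset.sum_nonneg fun k _ => hpos k
  unfold hitGap
  linarith

/-- The two set differences have equal size, so summing over all pairs repeats the gap that many
times. -/
theorem card_mul_hitGap {S : Finset (Fin L)} (hCL : C ≤ L) (hS : S.card = C) :
    ((S \ optimalCache L C).card : ℝ) * hitGap μ C S =
      ∑ i ∈ optimalCache L C \ S, ∑ j ∈ S \ optimalCache L C, (μ i - μ j) := by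
  have hc : (optimalCache L C \ S).card = (S \ optimalCache L C).card :=
    Finset.card_sdiff_comm (by rw [card_optimalCache hCL, hS])
  simp only [Finset.sum_sub_distrib, Finset.sum_const, nsmul_eq_mul, ← Finset.mul_sum, hc]
  rw [hitGap, ← Finset.sum_sdiff_sub_sum_sdiff, mul_sub]

theorem hitGap_le_sum_pairs (hμ : StrictAnti μ) (hC : 1 ≤ C) (hCL : C < L)
    {S : Finset (Fin L)} (hS : S.card = C) :
    hitGap μ C S ≤
      ∑ i ∈ optimalCache L C \ S, ∑ j ∈ S \ optimalCache L C, (μ i - μ j) := by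
  have hnn : 0 ≤ ∑ i ∈ optimalCache L C \ S, ∑ j ∈ S \ optimalCache L C, (μ i - μ j) :=
    Finset.sum_nonneg fun i hi => Finset.sum_nonneg fun j hj =>
      (deltaMin_pos hμ hC hCL).le.trans
        (deltaMin_le_sub hμ hCL (Finset.mem_sdiff.1 hi).1 (Finset.mem_sdiff.1 hj).2)
  have hmul := card_mul_hitGap (μ := μ) hCL.le hS
  rcases Nat.eq_zero_or_pos (S \ optimalCache L C).card with h0 | hpos
  · have hsub : S ⊆ optimalCache L C := by
      rwa [Finset.card_eq_zero, Finset.sdiff_eq_empty_iff_subset] at h0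
    have : S = optimalCache L C :=
      Finset.eq_of_subset_of_card_le hsub (by rw [card_optimalCache hCL.le, hS])
    simp [hitGap, this]
  · have h1 : (1 : ℝ) ≤ (S \ optimalCache L C).card := by exact_mod_cast hpos
    have hg : 0 ≤ hitGap μ C S := by
      by_contra! hneg
      nlinarith
    nlinarith

/-- Inverted pairs have weight product at least 1 and all terms are nonnegative, so the sum may be
extended to pairs independent of `S`; its expectation can then be taken term by term. -/
theorem hitGap_le_sum_pairWeight (hμ : StrictAnti μ) (hC : 1 ≤ C) (hCL : C < L) {n : ℕ}
    {h : Fin n → Fin L} {S : Finset (Fin L)} (hS : IsTopSet C (empiricalFreq h) S) :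
    hitGap μ C S ≤ ∑ i ∈ optimalCache L C, ∑ j ∈ (optimalCache L C)ᶜ,
      (μ i - μ j) * ∏ τ, pairWeight μ i j (h τ) := by
  have hlt : ∀ i ∈ optimalCache L C, ∀ j ∉ optimalCache L C, μ j < μ i := fun i hi j hj =>
    sub_pos.1 ((deltaMin_pos hμ hC hCL).trans_le (deltaMin_le_sub hμ hCL hi hj))
  have hnn : ∀ i ∈ optimalCache L C, ∀ j ∉ optimalCache L C,
      0 ≤ (μ i - μ j) * ∏ τ, pairWeight μ i j (h τ) := fun i hi j hj =>
    mul_nonneg (sub_nonneg.2 (hlt i hi j hj).le)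
      (Finset.prod_nonneg fun τ _ => pairWeight_nonneg (hlt i hi j hj).le _)
  refine (hitGap_le_sum_pairs hμ hC hCL hS.1).trans ?_
  calc _ ≤ ∑ i ∈ optimalCache L C \ S, ∑ j ∈ S \ optimalCache L C,
        (μ i - μ j) * ∏ τ, pairWeight μ i j (h τ) := by
        refine Finset.sum_le_sum fun i hi => Finset.sum_le_sum fun j hj => ?_
        rw [Finset.mem_sdiff] at hi hj
        have hl := hlt i hi.1 j hj.2
        exact le_mul_of_one_le_right (sub_nonneg.2 hl.le)
          (one_le_prod_pairWeight hl h (hS.count_le hi.2 hj.1))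
    _ ≤ ∑ i ∈ optimalCache L C \ S, ∑ j ∈ (optimalCache L C)ᶜ,
        (μ i - μ j) * ∏ τ, pairWeight μ i j (h τ) := by
        refine Finset.sum_le_sum fun i hi => Finset.sum_le_sum_of_subset_of_nonneg ?_ ?_
        · intro j hj
          exact Finset.mem_compl.2 (Finset.mem_sdiff.1 hj).2
        · intro j hj _
          exact hnn i (Finset.mem_sdiff.1 hi).1 j (Finset.mem_compl.1 hj)
    _ ≤ _ := Finset.sum_le_sum_of_subset_of_nonneg Finset.sdiff_subset fun i hi _ =>
        Finset.sum_nonneg fun j hj => hnn i hi j (Finset.mem_compl.1 hj)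

/-- A wrong cache holds some suboptimal `j` and misses some optimal `i`, with the count of `i` at
most that of `j`. Their means differ by at least nΔ the other way, so the deviations satisfy d_j -
d_i ≥ nΔ, while (d_j - d_i)² ≤ 2(d_i² + d_j²). -/
theorem sq_mul_deltaMin_le_sqDeviation (hμ : StrictAnti μ) (hC : 1 ≤ C) (hCL : C < L) {n : ℕ}
    {h : Fin n → Fin L} {S : Finset (Fin L)} (hS : IsTopSet C (empiricalFreq h) S)
    (hne : S ≠ optimalCache L C) :
    ((n : ℝ) * deltaMin μ C hCL) ^ 2 ≤ 2 * sqDeviation μ h := by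
  have hcard : S.card = (optimalCache L C).card := by rw [card_optimalCache hCL.le, hS.1]
  obtain ⟨j, hjS, hjO⟩ := Finset.not_subset.1 fun hsub =>
    hne (Finset.eq_of_subset_of_card_le hsub hcard.ge)
  obtain ⟨i, hiO, hiS⟩ := Finset.not_subset.1 fun hsub =>
    hne (Finset.eq_of_subset_of_card_le hsub hcard.le).symm
  have hij : i ≠ j := fun e => hjO (e ▸ hiO)
  have hcount : ((Finset.univ.filter fun τ => h τ = i).card : ℝ) ≤
      (Finset.univ.filter fun τ => h τ = j).card := by exact_mod_cast hS.count_le hiS hjS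
  have hΔ := mul_le_mul_of_nonneg_left (deltaMin_le_sub hμ hCL hiO hjO) (Nat.cast_nonneg (α := ℝ) n)
  have hD := mul_nonneg (Nat.cast_nonneg (α := ℝ) n) (deltaMin_pos hμ hC hCL).le
  have hpair : (∑ τ, ((if h τ = i then (1 : ℝ) else 0) - μ i)) ^ 2 +
      (∑ τ, ((if h τ = j then (1 : ℝ) else 0) - μ j)) ^ 2 ≤ sqDeviation μ h := by
    rw [← Finset.sum_pair (f := fun k => (∑ τ, ((if h τ = k then (1 : ℝ) else 0) - μ k)) ^ 2) hij]
    exact Finset.sum_le_sum_of_subset_of_nonneg (Finset.subset_univ _) fun _ _ _ => sq_nonneg _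
  simp only [Finset.sum_sub_distrib, sum_indicator_eq_card, Finset.sum_const, Finset.card_univ,
    Fintype.card_fin, nsmul_eq_mul] at hpair
  generalize ((Finset.univ.filter fun τ => h τ = i).card : ℝ) = a at *
  generalize ((Finset.univ.filter fun τ => h τ = j).card : ℝ) = b at *
  have hstep : (n : ℝ) * deltaMin μ C hCL ≤ (b - n * μ j) - (a - n * μ i) := by linarith
  have := pow_le_pow_left₀ hD hstep 2
  nlinarith [sq_nonneg ((b - n * μ j) + (a - n * μ i))]

theorem hitGap_le_sqDeviation (hμ : StrictAnti μ) (hpos : ∀ i, 0 ≤ μ i) (hsum : ∑ i, μ i = 1)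
    (hC : 1 ≤ C) (hCL : C < L) {n : ℕ} (hn : 0 < n) {h : Fin n → Fin L} {S : Finset (Fin L)}
    (hS : IsTopSet C (empiricalFreq h) S) :
    hitGap μ C S ≤ 4 / ((n : ℝ) * deltaMin μ C hCL) ^ 4 * sqDeviation μ h ^ 2 := by
  have hD : 0 < (n : ℝ) * deltaMin μ C hCL :=
    mul_pos (Nat.cast_pos.2 hn) (deltaMin_pos hμ hC hCL)
  by_cases hne : S = optimalCache L C
  · rw [hitGap, hne, sub_self]
    positivity
  · refine (hitGap_le_one hpos hsum S).trans ?_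
    have hk := pow_le_pow_left₀ (sq_nonneg _)
      (sq_mul_deltaMin_le_sqDeviation hμ hC hCL hS hne) 2
    rw [div_mul_eq_mul_div, one_le_div (by positivity)]
    linarith

end Cache

/-! ### Expected regret and summation over time -/

section Regret

variable {Ω : Type*} [MeasurableSpace Ω] {P : Measure Ω} [IsProbabilityMeasure P]
  {𝓤 : Type*} [MeasurableSpace 𝓤] {L C : ℕ} {μ : Fin L → ℝ} {x : ℕ → Ω → Fin L} {U : Ω → 𝓤}
  {π : CachingPolicy L 𝓤}

theorem IsLFU.measurable_comp (hπ : IsLFU C π) (n : ℕ) (G : Finset (Fin L) → ℝ) :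
    Measurable fun p : 𝓤 × (Fin n → Fin L) => G (π n p.2 p.1) := by
  -- There are finitely many histories, so measurability in the seed for each fixed history
  -- suffices.
  refine measurable_from_prod_countable_left fun h B _ => ?_
  have : (fun u => G (π n h u)) ⁻¹' B = ⋃ S ∈ G ⁻¹' B, {u | π n h u = S} := by
    ext u
    simp
  simp only [this]
  exact MeasurableSet.biUnion (Set.to_countable _) fun S _ => hπ.measurable n h S

theorem IsLFU.integrable_comp (hπ : IsLFU C π) (hx : ∀ n, Measurable (x n)) (hU : Measurable U)
    (n : ℕ) (G : Finset (Fin L) → Fin L → ℝ) :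
    Integrable (fun ω => G (cacheAt π (U ω) (fun k => x k ω) n) (x n ω)) P := by
  have hG : Measurable fun p : (𝓤 × (Fin n → Fin L)) × Fin L => G (π n p.1.2 p.1.1) p.2 :=
    measurable_from_prod_countable_left fun i => hπ.measurable_comp n fun S => G S i
  have hZ : Measurable fun ω => ((U ω, fun k : Fin n => x k ω), x n ω) :=
    (hU.prodMk (measurable_pi_lambda _ fun k : Fin n => hx k)).prodMk (hx n)
  refine Integrable.of_bound (hG.comp hZ).aestronglyMeasurable (∑ S, ∑ i, ‖G S i‖)
    (Filter.Eventually.of_forall fun ω => ?_)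
  refine (Finset.single_le_sum (f := fun i => ‖G (cacheAt π (U ω) (fun k => x k ω) n) i‖)
    (fun _ _ => norm_nonneg _) (Finset.mem_univ (x n ω))).trans ?_
  exact Finset.single_le_sum (f := fun S => ∑ i, ‖G S i‖)
    (fun _ _ => Finset.sum_nonneg fun _ _ => norm_nonneg _) (Finset.mem_univ _)

theorem integrable_regret (hπ : IsLFU C π) (hx : ∀ n, Measurable (x n)) (hU : Measurable U)
    (T : ℕ) : Integrable (fun ω => regret C π (U ω) (fun n => x n ω) T) P :=
  integrable_finsetSum _ fun n _ => hπ.integrable_comp hx hU n fun S i =>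
    (if i ∈ optimalCache L C then (1 : ℝ) else 0) - (if i ∈ S then (1 : ℝ) else 0)

theorem integral_regret (hπ : IsLFU C π) (hx : ∀ n, Measurable (x n)) (hU : Measurable U)
    (hlaw : ∀ n i, P.real {ω | x n ω = i} = μ i) (hindep : iIndepFun x P)
    (hUx : IndepFun U (fun ω n => x n ω) P) (T : ℕ) :
    ∫ ω, regret C π (U ω) (fun n => x n ω) T ∂P =
      ∑ n ∈ Finset.range T, ∫ ω, hitGap μ C (cacheAt π (U ω) (fun k => x k ω) n) ∂P := by
  unfold regret
  rw [integral_finsetSum _ fun n _ => hπ.integrable_comp hx hU n fun S i =>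
    (if i ∈ optimalCache L C then (1 : ℝ) else 0) - (if i ∈ S then (1 : ℝ) else 0)]
  refine Finset.sum_congr rfl fun n _ => ?_
  have h := integral_comp_eq_integral_sum_of_indepFun
    (indepFun_seed_history hx hindep hU hUx n) (hx n)
    (F := fun p i => (if i ∈ optimalCache L C then (1 : ℝ) else 0) -
      (if i ∈ π n p.2 p.1 then (1 : ℝ) else 0))
    (fun i => hπ.measurable_comp n fun S => (if i ∈ optimalCache L C then (1 : ℝ) else 0) -
      (if i ∈ S then (1 : ℝ) else 0))
    fun i => hπ.integrable_comp hx hU n fun S _ =>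
      (if i ∈ optimalCache L C then (1 : ℝ) else 0) - (if i ∈ S then (1 : ℝ) else 0)
  refine h.trans (integral_congr_ae (Filter.Eventually.of_forall fun ω => ?_))
  simp [hlaw, hitGap, cacheAt, mul_sub, Finset.sum_sub_distrib]

theorem integral_hitGap_le_one (hπ : IsLFU C π) (hx : ∀ n, Measurable (x n)) (hU : Measurable U)
    (hpos : ∀ i, 0 ≤ μ i) (hsum : ∑ i, μ i = 1) (n : ℕ) :
    ∫ ω, hitGap μ C (cacheAt π (U ω) (fun k => x k ω) n) ∂P ≤ 1 := by
  calc _ ≤ ∫ _, (1 : ℝ) ∂P :=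
        integral_mono (hπ.integrable_comp hx hU n fun S _ => hitGap μ C S) (integrable_const _)
          fun ω => hitGap_le_one hpos hsum _
    _ = 1 := by simp

theorem integral_hitGap_le_inv_sq (hπ : IsLFU C π) (hx : ∀ n, Measurable (x n))
    (hU : Measurable U) (hlaw : ∀ n i, P.real {ω | x n ω = i} = μ i) (hindep : iIndepFun x P)
    (hμ : StrictAnti μ) (hpos : ∀ i, 0 ≤ μ i) (hsum : ∑ i, μ i = 1) (hC : 1 ≤ C) (hCL : C < L)
    {n : ℕ} (hn : 0 < n) :
    ∫ ω, hitGap μ C (cacheAt π (U ω) (fun k => x k ω) n) ∂P ≤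
      24 / deltaMin μ C hCL ^ 4 * ((n : ℝ) ^ 2)⁻¹ := by
  have hD := deltaMin_pos hμ hC hCL
  have hn' : (0 : ℝ) < n := Nat.cast_pos.2 hn
  calc _ ≤ ∫ ω, 4 / ((n : ℝ) * deltaMin μ C hCL) ^ 4 *
          sqDeviation μ (fun k : Fin n => x k ω) ^ 2 ∂P :=
        integral_mono (hπ.integrable_comp hx hU n fun S _ => hitGap μ C S)
          (integrable_comp_history hx fun h =>
            4 / ((n : ℝ) * deltaMin μ C hCL) ^ 4 * sqDeviation μ h ^ 2)
          fun ω => hitGap_le_sqDeviation hμ hpos hsum hC hCL hn (hπ.top _ _ _)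
    _ ≤ 4 / ((n : ℝ) * deltaMin μ C hCL) ^ 4 * (6 * (n : ℝ) ^ 2) := by
        rw [integral_const_mul]
        exact mul_le_mul_of_nonneg_left
          (integral_sqDeviation_sq_le hpos hsum hx hlaw hindep n) (by positivity)
    _ = _ := by
        field_simp
        norm_num

theorem integral_hitGap_le_sum_pow (hπ : IsLFU C π) (hx : ∀ n, Measurable (x n))
    (hU : Measurable U) (hlaw : ∀ n i, P.real {ω | x n ω = i} = μ i) (hindep : iIndepFun x P)
    (hμ : StrictAnti μ) (hC : 1 ≤ C) (hCL : C < L) (n : ℕ) :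
    ∫ ω, hitGap μ C (cacheAt π (U ω) (fun k => x k ω) n) ∂P ≤
      ∑ i ∈ optimalCache L C, ∑ j ∈ (optimalCache L C)ᶜ,
        (μ i - μ j) * (∑ k, μ k * pairWeight μ i j k) ^ n := by
  calc _ ≤ ∫ ω, ∑ i ∈ optimalCache L C, ∑ j ∈ (optimalCache L C)ᶜ,
          (μ i - μ j) * ∏ τ : Fin n, pairWeight μ i j (x τ ω) ∂P :=
        integral_mono (hπ.integrable_comp hx hU n fun S _ => hitGap μ C S)
          (integrable_comp_history hx (n := n) fun h =>
            ∑ i ∈ optimalCache L C, ∑ j ∈ (optimalCache L C)ᶜ,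
              (μ i - μ j) * ∏ τ : Fin n, pairWeight μ i j (h τ))
          fun ω => hitGap_le_sum_pairWeight hμ hC hCL (hπ.top _ _ _)
    _ = _ := by
        rw [integral_finsetSum _ fun i _ => integrable_comp_history hx (n := n) fun h =>
          ∑ j ∈ (optimalCache L C)ᶜ, (μ i - μ j) * ∏ τ : Fin n, pairWeight μ i j (h τ)]
        refine Finset.sum_congr rfl fun i _ => ?_
        rw [integral_finsetSum _ fun j _ => integrable_comp_history hx (n := n) fun h =>
          (μ i - μ j) * ∏ τ : Fin n, pairWeight μ i j (h τ)]
        refine Finset.sum_congr rfl fun j _ => ?_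
        rw [integral_const_mul, integral_prod_pairWeight hx hlaw hindep]

theorem sum_range_le_of_le_inv_sq {a : ℕ → ℝ} {K : ℝ} (hK : 0 ≤ K) (h1 : ∀ n, a n ≤ 1)
    (h2 : ∀ n, 0 < n → a n ≤ K * ((n : ℝ) ^ 2)⁻¹) {M : ℕ} (hM : 0 < M) (T : ℕ) :
    ∑ n ∈ Finset.range T, a n ≤ M + 1 + K / M := by
  have hMT : M + 1 ≤ T + M + 1 := by omega
  calc ∑ n ∈ Finset.range T, a n
      ≤ ∑ n ∈ Finset.range T, (if n ≤ M then 1 else K * ((n : ℝ) ^ 2)⁻¹) := by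
        refine Finset.sum_le_sum fun n _ => ?_
        split_ifs with hn
        · exact h1 n
        · exact h2 n (by omega)
    -- Lengthening the range makes it contain all of 0, …, M even when `T` is small.
    _ ≤ ∑ n ∈ Finset.range (T + M + 1), (if n ≤ M then 1 else K * ((n : ℝ) ^ 2)⁻¹) := by
        refine Finset.sum_le_sum_of_subset_of_nonneg (Finset.range_mono (by omega)) ?_
        intro n _ _
        split_ifs <;> positivity
    _ = ∑ n ∈ Finset.range (M + 1), 1 + ∑ n ∈ Finset.Ioc M (T + M), K * ((n : ℝ) ^ 2)⁻¹ := by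
        rw [← Finset.sum_range_add_sum_Ico _ hMT]
        congr 1
        · refine Finset.sum_congr rfl fun n hn => if_pos ?_
          have := Finset.mem_range.1 hn
          omega
        · have : Finset.Ico (M + 1) (T + M + 1) = Finset.Ioc M (T + M) := by
            ext n
            simp only [Finset.mem_Ico, Finset.mem_Ioc]
            omega
          rw [this]
          refine Finset.sum_congr rfl fun n hn => if_neg ?_
          have := Finset.mem_Ioc.1 hn
          omega
    _ ≤ M + 1 + K / M := by
        rw [← Finset.mul_sum, div_eq_mul_inv]
        have hsq := sum_Ioc_inv_sq_le_sub (α := ℝ) hM.ne' (Nat.le_add_left M T)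
        have hinv : (0 : ℝ) ≤ ((T + M : ℕ) : ℝ)⁻¹ := by positivity
        have := mul_le_mul_of_nonneg_left (hsq.trans (sub_le_self _ hinv)) hK
        simpa using this

theorem sum_range_pow_le_of_le_one_sub {ρ d : ℝ} (hρ : 0 ≤ ρ) (hd : 0 < d) (h : ρ ≤ 1 - d)
    (T : ℕ) : ∑ n ∈ Finset.range T, ρ ^ n ≤ 1 / d := by
  have hg := mul_neg_geom_sum ρ T
  have h0 : 0 ≤ ∑ n ∈ Finset.range T, ρ ^ n := Finset.sum_nonneg fun n _ => pow_nonneg hρ n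
  rw [le_div_iff₀ hd]
  nlinarith [pow_nonneg hρ T]

theorem integral_regret_lt_sixteen_div (hπ : IsLFU C π) (hx : ∀ n, Measurable (x n))
    (hU : Measurable U) (hlaw : ∀ n i, P.real {ω | x n ω = i} = μ i) (hindep : iIndepFun x P)
    (hUx : IndepFun U (fun ω n => x n ω) P) (hμ : StrictAnti μ) (hpos : ∀ i, 0 ≤ μ i)
    (hsum : ∑ i, μ i = 1) (hC : 1 ≤ C) (hCL : C < L) (T : ℕ) :
    ∫ ω, regret C π (U ω) (fun n => x n ω) T ∂P < 16 / deltaMin μ C hCL ^ 2 := by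
  have hD := deltaMin_pos hμ hC hCL
  have hD1 : deltaMin μ C hCL ≤ 1 := by
    have h₁ : μ ⟨C - 1, by omega⟩ ≤ 1 :=
      hsum ▸ Finset.single_le_sum (fun k _ => hpos k) (Finset.mem_univ _)
    have h₂ := hpos ⟨C, hCL⟩
    unfold deltaMin
    linarith
  rw [integral_regret hπ hx hU hlaw hindep hUx]
  have hinv2 : 1 ≤ 1 / deltaMin μ C hCL ^ 2 := by
    rw [one_le_div (by positivity)]
    exact pow_le_one₀ hD.le hD1
  -- The cutoff ⌈5/Δ²⌉ nearly balances M against 24/(Δ⁴M). As Δ ≤ 1, M + 1 < 5/Δ² + 2 ≤ 7/Δ², and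
  -- the tail is at most 4.8/Δ², for a total below 16/Δ².
  have hM := Nat.le_ceil (5 / deltaMin μ C hCL ^ 2)
  have hM' := Nat.ceil_lt_add_one (a := 5 / deltaMin μ C hCL ^ 2) (by positivity)
  have hMpos : 0 < ⌈5 / deltaMin μ C hCL ^ 2⌉₊ := Nat.ceil_pos.2 (by positivity)
  have hbound := sum_range_le_of_le_inv_sq (K := 24 / deltaMin μ C hCL ^ 4) (by positivity)
    (fun n => integral_hitGap_le_one hπ hx hU hpos hsum n)
    (fun n hn => integral_hitGap_le_inv_sq hπ hx hU hlaw hindep hμ hpos hsum hC hCL hn) hMpos T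
  have htail : 24 / deltaMin μ C hCL ^ 4 / (⌈5 / deltaMin μ C hCL ^ 2⌉₊ : ℝ) ≤
      24 / 5 * (1 / deltaMin μ C hCL ^ 2) := by
    calc _ ≤ 24 / deltaMin μ C hCL ^ 4 / (5 / deltaMin μ C hCL ^ 2) := by gcongr
      _ = _ := by field_simp
  have e5 : 5 / deltaMin μ C hCL ^ 2 = 5 * (1 / deltaMin μ C hCL ^ 2) := by ring
  have e16 : 16 / deltaMin μ C hCL ^ 2 = 16 * (1 / deltaMin μ C hCL ^ 2) := by ring
  linarith

theorem integral_regret_lt_pairs_div (hπ : IsLFU C π) (hx : ∀ n, Measurable (x n))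
    (hU : Measurable U) (hlaw : ∀ n i, P.real {ω | x n ω = i} = μ i) (hindep : iIndepFun x P)
    (hUx : IndepFun U (fun ω n => x n ω) P) (hμ : StrictAnti μ) (hpos : ∀ i, 0 ≤ μ i)
    (hsum : ∑ i, μ i = 1) (hC : 1 ≤ C) (hCL : C < L) (T : ℕ) :
    ∫ ω, regret C π (U ω) (fun n => x n ω) T ∂P <
      4 * (C : ℝ) * ((L : ℝ) - (C : ℝ)) / deltaMin μ C hCL := by
  have hD := deltaMin_pos hμ hC hCL
  rw [integral_regret hπ hx hU hlaw hindep hUx]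
  calc _ ≤ ∑ n ∈ Finset.range T, ∑ i ∈ optimalCache L C, ∑ j ∈ (optimalCache L C)ᶜ,
          (μ i - μ j) * (∑ k, μ k * pairWeight μ i j k) ^ n :=
        Finset.sum_le_sum fun n _ =>
          integral_hitGap_le_sum_pow hπ hx hU hlaw hindep hμ hC hCL n
    _ = ∑ i ∈ optimalCache L C, ∑ j ∈ (optimalCache L C)ᶜ,
          (μ i - μ j) * ∑ n ∈ Finset.range T, (∑ k, μ k * pairWeight μ i j k) ^ n := by
        rw [Finset.sum_comm]
        refine Finset.sum_congr rfl fun i _ => ?_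
        rw [Finset.sum_comm]
        simp only [Finset.mul_sum]
    _ ≤ ∑ i ∈ optimalCache L C, ∑ j ∈ (optimalCache L C)ᶜ, 2 / deltaMin μ C hCL := by
        refine Finset.sum_le_sum fun i hi => Finset.sum_le_sum fun j hj => ?_
        have hle := deltaMin_le_sub hμ hCL hi (Finset.mem_compl.1 hj)
        have hd : 0 < μ i - μ j := hD.trans_le hle
        have hlt : μ j < μ i := sub_pos.1 hd
        calc _ ≤ (μ i - μ j) * (1 / ((μ i - μ j) ^ 2 / 2)) :=
              mul_le_mul_of_nonneg_left (sum_range_pow_le_of_le_one_sub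
                (Finset.sum_nonneg fun k _ => mul_nonneg (hpos k) (pairWeight_nonneg hlt.le k))
                (by positivity) (sum_mul_pairWeight_le hpos hsum hlt) T) hd.le
          _ = 2 / (μ i - μ j) := by field_simp
          _ ≤ _ := by gcongr
    _ = 2 * (C : ℝ) * ((L : ℝ) - C) / deltaMin μ C hCL := by
        simp only [Finset.sum_const, Finset.card_compl, card_optimalCache hCL.le,
          Fintype.card_fin, nsmul_eq_mul, Nat.cast_sub hCL.le]
        ring
    _ < _ := by
        -- Strictness comes from the spare factor 2, since C(L - C) > 0.
        have hC' : (0 : ℝ) < C := Nat.cast_pos.2 hC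
        have hLC : (0 : ℝ) < (L : ℝ) - C := sub_pos.2 (Nat.cast_lt.2 hCL)
        have := mul_pos hC' hLC
        gcongr
        norm_num

end Regret

theorem theorem1 {Ω : Type*} [MeasurableSpace Ω] (P : Measure Ω) [IsProbabilityMeasure P]
    {𝓤 : Type*} [MeasurableSpace 𝓤]
    (L C : ℕ) (hC : 1 ≤ C) (hCL : C < L)
    (μ : Fin L → ℝ) (hμ_sum : ∑ i, μ i = 1) (hμ : StrictAnti μ)
    (x : ℕ → Ω → Fin L) (hx_meas : ∀ n, Measurable (x n))
    (hx_law : ∀ n i, P.real {ω | x n ω = i} = μ i)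
    (hx_indep : iIndepFun x P)
    (U : Ω → 𝓤) (hU_meas : Measurable U)
    (hU_indep : IndepFun U (fun ω n => x n ω) P)
    (π : CachingPolicy L 𝓤) (hπ : IsLFU C π) (T : ℕ) :
    Integrable (fun ω => regret C π (U ω) (fun n => x n ω) T) P ∧
      ∫ ω, regret C π (U ω) (fun n => x n ω) T ∂P <
        min (16 / deltaMin μ C hCL ^ 2)
          (4 * (C : ℝ) * ((L : ℝ) - (C : ℝ)) / deltaMin μ C hCL) := by
  have hpos : ∀ i, 0 ≤ μ i := fun i => hx_law 0 i ▸ measureReal_nonneg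
  exact ⟨integrable_regret hπ hx_meas hU_meas T, lt_min
    (integral_regret_lt_sixteen_div hπ hx_meas hU_meas hx_law hx_indep hU_indep hμ hpos hμ_sum
      hC hCL T)
    (integral_regret_lt_pairs_div hπ hx_meas hU_meas hx_law hx_indep hU_indep hμ hpos hμ_sum
      hC hCL T)⟩
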